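/- Let $n \in \{4,5\}$. Then there is no tight harmonic index $4$-design on the unit sphere $S^{n-1} \subset \mathbb{R}^n$. Here a harmonic index $t$-design on $S^{n-1}$ is a finite nonempty subset $X \subset S^{n-1}$ such that $\sum_{x \in X} f(x) = 0$ for every real polynomial $f$ in $n$ variables that is homogeneous of degree $t$ and harmonic (i.e. $\sum_{i=1}^n \partial^2 f/\partial x_i^2 = 0$). For $n \ge 2$ and even $t \ge 2$, put $d_{n,t} = \binom{n+t-1}{t} - \binom{n+t-3}{t-2}$, and let $Q_{n,t}$ be the multiple of the Gegenbauer polynomial $C_t^{(n-2)/2}$ normalized by $Q_{n,t}(1) = d_{n,t}$. For $\lambda \neq 0$ the Gegenbauer polynomials are defined by $(1-2xr+r^2)^{-\lambda} = \sum_{t \ge 0} C_t^{\lambda}(x)\, r^t$, and $C_t^0$ is the Chebyshev polynomial of the first kind, $C_t^0(x) = \cos(t \arccos x)$ for $-1 \le x \le 1$. Put $$c_{n,t} = -\min_{-1 \le x \le 1} Q_{n,t}(x), \qquad b_{n,t} = 1 + \frac{d_{n,t}}{c_{n,t}}.$$ A harmonic index $t$-design $X$ on $S^{n-1}$ is called tight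 if $|X| = b_{n,t}$ (which in particular requires $b_{n,t}$ to be an integer). -/

import Mathlib

namespace HarmonicIndexDesign

/-- The Laplacian `∑ i, ∂²/∂xᵢ²` on real polynomials in `n` variables. -/
noncomputable def laplacian (n : ℕ) : MvPolynomial (Fin n) ℝ →ₗ[ℝ] MvPolynomial (Fin n) ℝ :=
  ∑ i : Fin n, (MvPolynomial.pderiv i).toLinearMap ∘ₗ (MvPolynomial.pderiv i).toLinearMap

/-- The space of harmonic homogeneous polynomials of degree `t` on `ℝⁿ`. -/
noncomputable def Harm (n t : ℕ) : Submodule ℝ (MvPolynomial (Fin n) ℝ) :=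
  MvPolynomial.homogeneousSubmodule (Fin n) ℝ t ⊓ LinearMap.ker (laplacian n)

/-- A finite nonempty subset `X` of the unit sphere of `ℝⁿ` is a spherical design of harmonic
index `t` if every harmonic homogeneous polynomial of degree `t` sums to zero over `X`. -/
def IsDesign {n : ℕ} (t : ℕ) (X : Finset (EuclideanSpace ℝ (Fin n))) : Prop :=
  X.Nonempty ∧ (∀ x ∈ X, x ∈ Metric.sphere (0 : EuclideanSpace ℝ (Fin n)) 1) ∧
    ∀ f ∈ Harm n t, ∑ x ∈ X, MvPolynomial.eval (fun i => x i) f = 0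

/-- The Gegenbauer polynomial `C_t^μ`, as a function on `ℝ`: for `μ ≠ 0`, the coefficient of `r ^ t`
in the power series expansion at `r = 0` of `(1 - 2 x r + r²) ^ (-μ)`; for `μ = 0`, the Chebyshev
polynomial of the first kind. -/
noncomputable def gegenbauer (μ : ℝ) (t : ℕ) (x : ℝ) : ℝ :=
  if μ = 0 then (Polynomial.Chebyshev.T ℝ (t : ℤ)).eval x
  else iteratedDeriv t (fun r : ℝ => (1 - 2 * x * r + r ^ 2) ^ (-μ)) 0 / (t.factorial : ℝ)

/-- The number `binom (n+t-1) t - binom (n+t-3) (t-2)`, where a binomial coefficient with a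
negative lower entry is zero. -/
noncomputable def harmDim (n t : ℕ) : ℝ :=
  ((n + t - 1).choose t : ℝ) - (if 2 ≤ t then ((n + t - 3).choose (t - 2) : ℝ) else 0)

/-- The multiple `Q_{n,t}` of the Gegenbauer polynomial `C_t^{(n-2)/2}` whose value at `1` is
`harmDim n t`. -/
noncomputable def Q (n t : ℕ) (x : ℝ) : ℝ :=
  harmDim n t / gegenbauer (((n : ℝ) - 2) / 2) t 1 * gegenbauer (((n : ℝ) - 2) / 2) t x

/-- `c_{n,t} = - min_{-1 ≤ x ≤ 1} Q_{n,t}(x)`. -/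
noncomputable def c (n t : ℕ) : ℝ :=
  -sInf (Q n t '' Set.Icc (-1) 1)

/-- The Fisher type lower bound `b_{n,t}` for designs of harmonic index `t`. -/
noncomputable def b (n t : ℕ) : ℝ :=
  1 + 1 / c n t * harmDim n t

/-- A design of harmonic index `t` in `ℝⁿ` is tight if its cardinality is exactly `b_{n,t}`
(so that `b_{n,t}` is in particular an integer). -/
def IsTightDesign {n : ℕ} (t : ℕ) (X : Finset (EuclideanSpace ℝ (Fin n))) : Prop :=
  IsDesign t X ∧ (X.card : ℝ) = b n t

end HarmonicIndexDesign

namespace HarmonicIndexDesign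

open MvPolynomial Filter Topology

/-! ### Zonal harmonic polynomials of degree four -/

/-! Tightness forces `|X| = (n+1)(n+2)/6`, that is 5 or 7. Testing the design against zonal quartics
gives an identity between the fourth and second moments of `⟪x, y⟫` for every `y`. For `y ∈ X` it
makes all the other points satisfy `⟪x, y⟫² = a := 3/(n+4)` (`inner_sq_of_card`). For `y ± v` with
`v ⊥ y` it makes the frame operator act as the scalar `(n+1)/6` on `y^⊥`
(`sum_inner_sq_of_orthogonal`).

So `B(u,v) = ∑ ⟪w,u⟫⟪w,v⟫ - (n+1)/6 ⟪u,v⟫` vanishes on `p^⊥` for each `p ∈ X`, with `B(p,p) =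
(n+1)/3`. For three distinct points, this computes one value of `B` in two ways; comparing them
gives `a²(1-a)² = 0`, although `0 < a < 1` (`card_ne`). -/

/-- The linear form `x ↦ ⟪x, y⟫` as a polynomial. -/
noncomputable def linearForm {n : ℕ} (y : Fin n → ℝ) : MvPolynomial (Fin n) ℝ :=
  ∑ i, C (y i) * X i

/-- The squared norm as a polynomial. -/
noncomputable def normSqPoly (n : ℕ) : MvPolynomial (Fin n) ℝ :=
  ∑ i, X i ^ 2

/-- The zonal harmonic polynomial of degree four with pole `y`. -/
noncomputable def zonalFour {n : ℕ} (y : Fin n → ℝ) : MvPolynomial (Fin n) ℝ :=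
  linearForm y ^ 4
    - C (6 / ((n : ℝ) + 4) * ∑ i, y i ^ 2) * (normSqPoly n * linearForm y ^ 2)
    + C (3 / (((n : ℝ) + 4) * ((n : ℝ) + 2)) * (∑ i, y i ^ 2) ^ 2) * normSqPoly n ^ 2

theorem pderiv_linearForm {n : ℕ} (y : Fin n → ℝ) (i : Fin n) :
    pderiv i (linearForm y) = C (y i) := by
  simp [linearForm, pderiv_X, Pi.single_apply, Finset.sum_ite_eq']

theorem pderiv_normSqPoly {n : ℕ} (i : Fin n) :
    pderiv i (normSqPoly n) = 2 * X i := by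
  simp [normSqPoly, pderiv_X, Pi.single_apply, Derivation.leibniz_pow]

theorem isHomogeneous_linearForm {n : ℕ} (y : Fin n → ℝ) : (linearForm y).IsHomogeneous 1 :=
  IsHomogeneous.sum _ _ _ fun i _ => isHomogeneous_C_mul_X (y i) i

theorem isHomogeneous_normSqPoly (n : ℕ) : (normSqPoly n).IsHomogeneous 2 :=
  IsHomogeneous.sum _ _ _ fun i _ => isHomogeneous_X_pow i 2

theorem laplacian_apply {n : ℕ} (f : MvPolynomial (Fin n) ℝ) :
    laplacian n f = ∑ i, pderiv i (pderiv i f) := by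
  simp [laplacian]

theorem laplacian_linearForm_pow_four {n : ℕ} (y : Fin n → ℝ) :
    laplacian n (linearForm y ^ 4) = C (12 * ∑ i, y i ^ 2) * linearForm y ^ 2 := by
  have h (i : Fin n) : pderiv i (pderiv i (linearForm y ^ 4))
      = 12 * linearForm y ^ 2 * C (y i) ^ 2 := by
    have h2 : pderiv i (C (y i)) = 0 := pderiv_C
    simp only [pderiv_pow, pderiv_mul, pderiv_linearForm, h2,
      Derivation.map_natCast]
    push_cast
    ring
  rw [laplacian_apply, Finset.sum_congr rfl fun i _ => h i, ← Finset.mul_sum]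
  simp only [map_mul, map_sum, map_pow, map_ofNat]
  ring

theorem laplacian_normSqPoly_mul_linearForm_sq {n : ℕ} (y : Fin n → ℝ) :
    laplacian n (normSqPoly n * linearForm y ^ 2)
      = C (2 * (n : ℝ) + 8) * linearForm y ^ 2 + C (2 * ∑ i, y i ^ 2) * normSqPoly n := by
  have h (i : Fin n) : pderiv i (pderiv i (normSqPoly n * linearForm y ^ 2))
      = 2 * linearForm y ^ 2 + 8 * linearForm y * (C (y i) * X i)
        + 2 * normSqPoly n * C (y i) ^ 2 := by
    have h2 : pderiv i (C (y i)) = 0 := pderiv_C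
    have h3 : pderiv i (2 : MvPolynomial (Fin n) ℝ) = 0 := (pderiv i).map_natCast 2
    simp only [pderiv_pow, pderiv_mul, pderiv_linearForm, pderiv_normSqPoly, h2, h3, map_add,
      Derivation.map_natCast, pderiv_X_self]
    push_cast
    ring
  rw [laplacian_apply, Finset.sum_congr rfl fun i _ => h i, Finset.sum_add_distrib,
    Finset.sum_add_distrib, ← Finset.mul_sum _ _ (8 * linearForm y),
    ← Finset.mul_sum _ _ (2 * normSqPoly n),
    show ∑ i, C (y i) * X i = linearForm y from rfl]
  simp only [Finset.sum_const, Finset.card_univ, Fintype.card_fin, nsmul_eq_mul, map_add,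
    map_mul, map_sum, map_pow, map_ofNat, map_natCast]
  ring

theorem laplacian_normSqPoly_sq (n : ℕ) :
    laplacian n (normSqPoly n ^ 2) = C (4 * (n : ℝ) + 8) * normSqPoly n := by
  have h (i : Fin n) : pderiv i (pderiv i (normSqPoly n ^ 2))
      = 4 * normSqPoly n + 8 * X i ^ 2 := by
    have h3 : pderiv i (2 : MvPolynomial (Fin n) ℝ) = 0 := (pderiv i).map_natCast 2
    simp only [pderiv_pow, pderiv_mul, pderiv_normSqPoly, h3,
      Derivation.map_natCast, pderiv_X_self]
    push_cast
    ring
  rw [laplacian_apply, Finset.sum_congr rfl fun i _ => h i, Finset.sum_add_distrib,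
    ← Finset.mul_sum _ _ (8 : MvPolynomial (Fin n) ℝ), show ∑ i, X i ^ 2 = normSqPoly n from rfl]
  simp only [Finset.sum_const, Finset.card_univ, Fintype.card_fin, nsmul_eq_mul, map_add,
    map_mul, map_ofNat, map_natCast]
  ring

theorem zonalFour_mem_Harm {n : ℕ} (y : Fin n → ℝ) : zonalFour y ∈ Harm n 4 := by
  refine ⟨?_, ?_⟩
  · have hL := isHomogeneous_linearForm y
    have hR := isHomogeneous_normSqPoly n
    exact (((hL.pow 4).sub ((hR.mul (hL.pow 2)).C_mul _)).add ((hR.pow 2).C_mul _))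
  · have h4 : (n : ℝ) + 4 ≠ 0 := by positivity
    have h2 : (n : ℝ) + 2 ≠ 0 := by positivity
    change laplacian n (zonalFour y) = 0
    rw [zonalFour, map_add, map_sub, C_mul', C_mul', map_smul, map_smul,
      laplacian_linearForm_pow_four, laplacian_normSqPoly_mul_linearForm_sq,
      laplacian_normSqPoly_sq, ← C_mul', ← C_mul', mul_add, ← mul_assoc, ← mul_assoc, ← mul_assoc,
      ← C_mul, ← C_mul, ← C_mul]
    -- The two coefficients in `zonalFour` are those for which the `linearForm y ^ 2` terms and the
    -- `normSqPoly n` terms of the Laplacian cancel.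
    have e1 : 6 / ((n : ℝ) + 4) * (∑ i, y i ^ 2) * (2 * (n : ℝ) + 8) = 12 * ∑ i, y i ^ 2 := by
      field_simp
      ring
    have e2 : 3 / (((n : ℝ) + 4) * ((n : ℝ) + 2)) * (∑ i, y i ^ 2) ^ 2 * (4 * (n : ℝ) + 8)
        = 6 / ((n : ℝ) + 4) * (∑ i, y i ^ 2) * (2 * ∑ i, y i ^ 2) := by
      field_simp
      ring
    rw [e1, e2]
    ring

open scoped RealInnerProductSpace

theorem eval_zonalFour {n : ℕ} (x y : EuclideanSpace ℝ (Fin n)) (hx : ‖x‖ = 1) :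
    eval (fun i => x i) (zonalFour fun i => y i)
      = ⟪x, y⟫ ^ 4 - 6 / ((n : ℝ) + 4) * ⟪y, y⟫ * ⟪x, y⟫ ^ 2
        + 3 / (((n : ℝ) + 4) * ((n : ℝ) + 2)) * ⟪y, y⟫ ^ 2 := by
  have hL : eval (fun i => x i) (linearForm fun i => y i) = ⟪x, y⟫ := by
    simp [linearForm, PiLp.inner_apply]
  have hy : ∑ i, y i ^ 2 = ⟪y, y⟫ := by
    rw [PiLp.inner_apply]
    simp [sq]
  have hR : eval (fun i => x i) (normSqPoly n) = 1 := by
    have : ⟪x, x⟫ = 1 := by rw [real_inner_self_eq_norm_sq, hx, one_pow]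
    rw [← this, PiLp.inner_apply]
    simp [normSqPoly, sq]
  simp only [zonalFour, map_add, map_sub, map_mul, map_pow, hL, hR, eval_C, hy]
  ring

theorem IsDesign.sum_inner_pow_four {n : ℕ} {X : Finset (EuclideanSpace ℝ (Fin n))}
    (hX : IsDesign 4 X) (y : EuclideanSpace ℝ (Fin n)) :
    ∑ x ∈ X, ⟪x, y⟫ ^ 4 - 6 / ((n : ℝ) + 4) * ⟪y, y⟫ * ∑ x ∈ X, ⟪x, y⟫ ^ 2
      + X.card * (3 / (((n : ℝ) + 4) * ((n : ℝ) + 2))) * ⟪y, y⟫ ^ 2 = 0 := by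
  have h := hX.2.2 _ (zonalFour_mem_Harm fun i => y i)
  rw [Finset.sum_congr rfl fun x hx =>
    eval_zonalFour x y (by simpa using hX.2.1 x hx)] at h
  rw [Finset.sum_add_distrib, Finset.sum_sub_distrib, ← Finset.mul_sum, Finset.sum_const,
    nsmul_eq_mul] at h
  linarith

/-! ### Nonexistence in terms of cardinality -/

section Card

variable {n : ℕ} {X : Finset (EuclideanSpace ℝ (Fin n))}

theorem IsDesign.inner_self (hX : IsDesign 4 X) {x : EuclideanSpace ℝ (Fin n)} (hx : x ∈ X) :
    ⟪x, x⟫ = 1 := by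
  have : ‖x‖ = 1 := by simpa using hX.2.1 x hx
  rw [real_inner_self_eq_norm_sq, this, one_pow]

/-- The quartic identity for designs with the cardinality of tight designs. -/
theorem IsDesign.sum_inner_pow_four_of_card (hX : IsDesign 4 X)
    (hc : (X.card : ℝ) = (n + 1) * (n + 2) / 6) (y : EuclideanSpace ℝ (Fin n)) :
    2 * (n + 4) * ∑ x ∈ X, ⟪x, y⟫ ^ 4 - 12 * ⟪y, y⟫ * ∑ x ∈ X, ⟪x, y⟫ ^ 2
      + (n + 1) * ⟪y, y⟫ ^ 2 = 0 := by
  have h := hX.sum_inner_pow_four y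
  rw [hc] at h
  have h4 : (n : ℝ) + 4 ≠ 0 := by positivity
  have h2 : (n : ℝ) + 2 ≠ 0 := by positivity
  field_simp at h
  linarith

/-- The points of a tight design are equiangular. -/
theorem IsDesign.inner_sq_of_card (hX : IsDesign 4 X)
    (hc : (X.card : ℝ) = (n + 1) * (n + 2) / 6) {x y : EuclideanSpace ℝ (Fin n)}
    (hx : x ∈ X) (hy : y ∈ X) (hxy : x ≠ y) : ⟪x, y⟫ ^ 2 = 3 / ((n : ℝ) + 4) := by
  classical
  have h := hX.sum_inner_pow_four_of_card hc y
  have h4 : (n : ℝ) + 4 ≠ 0 := by positivity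
  have hyy := hX.inner_self hy
  rw [hyy] at h
  -- The right side is exactly the term `z = y`, so the remaining squares sum to zero.
  have hs : ∑ z ∈ X, (⟪z, y⟫ ^ 2 - 3 / ((n : ℝ) + 4)) ^ 2 = (1 - 3 / ((n : ℝ) + 4)) ^ 2 := by
    have e (z : EuclideanSpace ℝ (Fin n)) : (⟪z, y⟫ ^ 2 - 3 / ((n : ℝ) + 4)) ^ 2
        = ⟪z, y⟫ ^ 4 - 6 / ((n : ℝ) + 4) * ⟪z, y⟫ ^ 2 + (3 / ((n : ℝ) + 4)) ^ 2 := by ring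
    rw [Finset.sum_congr rfl fun z _ => e z, Finset.sum_add_distrib, Finset.sum_sub_distrib,
      ← Finset.mul_sum, Finset.sum_const, nsmul_eq_mul, hc]
    field_simp
    linear_combination 3 * ((n : ℝ) + 4) * h
  rw [← Finset.add_sum_erase _ _ hy, hyy, one_pow, add_eq_left,
    Finset.sum_eq_zero_iff_of_nonneg fun _ _ => sq_nonneg _] at hs
  exact sub_eq_zero.1 (pow_eq_zero_iff two_ne_zero |>.1 (hs x (Finset.mem_erase.2 ⟨hxy, hx⟩)))

theorem IsDesign.sum_inner_sq_of_card (hX : IsDesign 4 X)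
    (hc : (X.card : ℝ) = (n + 1) * (n + 2) / 6) {y : EuclideanSpace ℝ (Fin n)} (hy : y ∈ X) :
    ∑ x ∈ X, ⟪x, y⟫ ^ 2 = (n + 1) / 2 := by
  classical
  have h4 : (n : ℝ) + 4 ≠ 0 := by positivity
  rw [← Finset.add_sum_erase _ _ hy, hX.inner_self hy,
    Finset.sum_congr rfl fun x hx => hX.inner_sq_of_card hc (Finset.mem_of_mem_erase hx) hy
      (Finset.ne_of_mem_erase hx), Finset.sum_const, nsmul_eq_mul, Finset.cast_card_erase_of_mem hy,
    hc]
  field_simp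
  ring

/-- On the orthogonal complement of each of its points, the frame operator of a tight design is
a homothety. -/
theorem IsDesign.sum_inner_sq_of_orthogonal (hX : IsDesign 4 X)
    (hc : (X.card : ℝ) = (n + 1) * (n + 2) / 6) {y v : EuclideanSpace ℝ (Fin n)} (hy : y ∈ X)
    (hv : ⟪y, v⟫ = 0) : ∑ x ∈ X, ⟪x, v⟫ ^ 2 = (n + 1) / 6 * ⟪v, v⟫ := by
  classical
  have h4 : (n : ℝ) + 4 ≠ 0 := by positivity
  have hvy : ⟪v, y⟫ = 0 := by rw [real_inner_comm, hv]
  have hyy := hX.inner_self hy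
  -- Adding the identities at `y + v` and `y - v` removes the odd terms; equiangularity turns the
  -- mixed term into a second moment of `v`.
  have h1 := hX.sum_inner_pow_four_of_card hc (y + v)
  have h2 := hX.sum_inner_pow_four_of_card hc (y - v)
  have h3 := hX.sum_inner_pow_four_of_card hc y
  have h5 := hX.sum_inner_pow_four_of_card hc v
  have hS := hX.sum_inner_sq_of_card hc hy
  have hM : ∑ x ∈ X, ⟪x, y⟫ ^ 2 * ⟪x, v⟫ ^ 2 = 3 / ((n : ℝ) + 4) * ∑ x ∈ X, ⟪x, v⟫ ^ 2 := by
    rw [Finset.mul_sum]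
    refine Finset.sum_congr rfl fun x hx => ?_
    rcases eq_or_ne x y with rfl | hne
    · simp [hv]
    · rw [hX.inner_sq_of_card hc hx hy hne]
  have e4 : ∑ x ∈ X, ⟪x, y + v⟫ ^ 4 + ∑ x ∈ X, ⟪x, y - v⟫ ^ 4
      = 2 * ∑ x ∈ X, ⟪x, y⟫ ^ 4 + 2 * ∑ x ∈ X, ⟪x, v⟫ ^ 4
        + 12 * ∑ x ∈ X, ⟪x, y⟫ ^ 2 * ⟪x, v⟫ ^ 2 := by
    simp only [Finset.mul_sum, ← Finset.sum_add_distrib, inner_add_right, inner_sub_right]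
    exact Finset.sum_congr rfl fun x _ => by ring
  have e2 : ∑ x ∈ X, ⟪x, y + v⟫ ^ 2 + ∑ x ∈ X, ⟪x, y - v⟫ ^ 2
      = 2 * ∑ x ∈ X, ⟪x, y⟫ ^ 2 + 2 * ∑ x ∈ X, ⟪x, v⟫ ^ 2 := by
    simp only [Finset.mul_sum, ← Finset.sum_add_distrib, inner_add_right, inner_sub_right]
    exact Finset.sum_congr rfl fun x _ => by ring
  have n1 : ⟪y + v, y + v⟫ = 1 + ⟪v, v⟫ := by
    simp only [inner_add_left, inner_add_right, hv, hvy, hyy]; ring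
  have n2 : ⟪y - v, y - v⟫ = 1 + ⟪v, v⟫ := by
    simp only [inner_sub_left, inner_sub_right, hv, hvy, hyy]; ring
  rw [n1] at h1
  rw [n2] at h2
  rw [hyy, hS] at h3
  rw [hM] at e4
  rw [hS] at e2
  generalize ∑ x ∈ X, ⟪x, y + v⟫ ^ 4 = A1 at *
  generalize ∑ x ∈ X, ⟪x, y - v⟫ ^ 4 = A2 at *
  generalize ∑ x ∈ X, ⟪x, y + v⟫ ^ 2 = B1 at *
  generalize ∑ x ∈ X, ⟪x, y - v⟫ ^ 2 = B2 at *
  have key : (2 * ((n : ℝ) + 4)) * (12 * (3 / ((n : ℝ) + 4) * ∑ x ∈ X, ⟪x, v⟫ ^ 2))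
      = 72 * ∑ x ∈ X, ⟪x, v⟫ ^ 2 := by
    field_simp
    ring
  linear_combination (h1 + h2 - 2 * h3 - 2 * h5 - 2 * ((n : ℝ) + 4) * e4
    + 12 * (1 + ⟪v, v⟫) * e2 - key) / 48

/-- There is no design of harmonic index four with `(n + 1) (n + 2) / 6` points if `3 ≤ n`. -/
theorem IsDesign.card_ne (hn : 3 ≤ n) (hX : IsDesign 4 X) :
    (X.card : ℝ) ≠ (n + 1) * (n + 2) / 6 := by
  intro hc
  have hn' : (3 : ℝ) ≤ n := by exact_mod_cast hn
  have hcard : 2 < X.card := by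
    have : (2 : ℝ) < X.card := by rw [hc]; nlinarith
    exact_mod_cast this
  obtain ⟨x, y, z, hx, hy, hz, hxy, hxz, hyz⟩ := Finset.two_lt_card_iff.1 hcard
  let B (u v : EuclideanSpace ℝ (Fin n)) : ℝ :=
    ∑ w ∈ X, ⟪w, u⟫ * ⟪w, v⟫ - (n + 1) / 6 * ⟪u, v⟫
  let k : ℝ := ((n : ℝ) + 1) / 3
  have hk : k ≠ 0 := by positivity
  have hBself {u : EuclideanSpace ℝ (Fin n)} (hu : u ∈ X) : B u u = k := by
    have := hX.sum_inner_sq_of_card hc hu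
    simp only [sq] at this
    simp only [B, k, this, hX.inner_self hu]
    ring
  have hBcomm (u v : EuclideanSpace ℝ (Fin n)) : B u v = B v u := by
    simp only [B, real_inner_comm u v, mul_comm]
  have hBsub (u v w p : EuclideanSpace ℝ (Fin n)) (s t : ℝ) :
      B (u - s • w) (v - t • p) = B u v - t * B u p - s * B w v + s * t * B w p := by
    have e : ∑ a ∈ X, ⟪a, u - s • w⟫ * ⟪a, v - t • p⟫
        = ∑ a ∈ X, ⟪a, u⟫ * ⟪a, v⟫ - t * ∑ a ∈ X, ⟪a, u⟫ * ⟪a, p⟫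
          - s * ∑ a ∈ X, ⟪a, w⟫ * ⟪a, v⟫ + s * t * ∑ a ∈ X, ⟪a, w⟫ * ⟪a, p⟫ := by
      simp only [Finset.mul_sum, ← Finset.sum_add_distrib, ← Finset.sum_sub_distrib,
        inner_sub_right, inner_smul_right]
      exact Finset.sum_congr rfl fun a _ => by ring
    simp only [B]
    rw [e]
    simp only [inner_sub_left, inner_sub_right, inner_smul_left, inner_smul_right,
      RCLike.conj_to_real]
    ring
  have hB0 {p u v : EuclideanSpace ℝ (Fin n)} (hp : p ∈ X) (hu : ⟪p, u⟫ = 0) (hv : ⟪p, v⟫ = 0) :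
      B u v = 0 := by
    have hq {w : EuclideanSpace ℝ (Fin n)} (hw : ⟪p, w⟫ = 0) : B w w = 0 := by
      have := hX.sum_inner_sq_of_orthogonal hc hp hw
      simp only [sq] at this
      simp only [B, this]
      ring
    -- Polarization: with both scalars `-1` this expands `B (u + v) (u + v)`.
    have h := hBsub u u v v (-1) (-1)
    rw [hq (w := u - (-1 : ℝ) • v) (by simp [inner_add_right, hu, hv]), hq hu, hq hv,
      hBcomm v u] at h
    linarith
  have horth {p u : EuclideanSpace ℝ (Fin n)} (hp : p ∈ X) : ⟪p, u - ⟪p, u⟫ • p⟫ = 0 := by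
    rw [inner_sub_right, inner_smul_right, hX.inner_self hp]
    ring
  have hpair {p u : EuclideanSpace ℝ (Fin n)} (hp : p ∈ X) (hu : u ∈ X) (hpu : p ≠ u) :
      2 * ⟪p, u⟫ * B p u = k * (1 + 3 / ((n : ℝ) + 4)) := by
    have h := hBsub u u p p ⟪p, u⟫ ⟪p, u⟫
    rw [hB0 hp (horth hp) (horth hp), hBself hp, hBself hu, hBcomm u p] at h
    rw [← hX.inner_sq_of_card hc hp hu hpu]
    linarith
  have h12 := hpair hx hy hxy
  have h13 := hpair hx hz hxz
  have h23 := hpair hy hz hyz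
  have s12 := hX.inner_sq_of_card hc hx hy hxy
  have s13 := hX.inner_sq_of_card hc hx hz hxz
  have s23 := hX.inner_sq_of_card hc hy hz hyz
  -- The components of `y` and `z` orthogonal to `x` are `B`-orthogonal, which expresses `B y z`
  -- through `B x y` and `B x z`.
  have h0 := hBsub y z x x ⟪x, y⟫ ⟪x, z⟫
  rw [hB0 hx (horth hx) (horth hx), hBself hx, hBcomm y x] at h0
  have ha0 : 0 < 3 / ((n : ℝ) + 4) := by positivity
  have ha1 : 3 / ((n : ℝ) + 4) < 1 := by rw [div_lt_one (by positivity)]; linarith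
  generalize 3 / ((n : ℝ) + 4) = a at *
  generalize ⟪x, y⟫ = p at *
  generalize ⟪x, z⟫ = q at *
  generalize ⟪y, z⟫ = r at *
  -- The factor `p * q` clears the denominators in `B x y = k(1+a)/(2p)` and `B x z = k(1+a)/(2q)`.
  have e1 : p * q * B y z = a * k := by
    linear_combination (-p * q) * h0 + (q ^ 2 / 2) * h12 + (p ^ 2 / 2) * h13
      + (k * (1 + a) / 2 - k * a) * s12 + (k * (1 + a) / 2 - k * p ^ 2) * s13
  have e2 : p * q * (1 + a) = 2 * a * r := by
    apply mul_left_cancel₀ hk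
    linear_combination 2 * r * e1 - p * q * h23
  -- Squaring removes the unknown signs of `p`, `q`, `r` and leaves `a²(1+a)² = 4a³`.
  have e3 : a ^ 2 * (1 - a) ^ 2 = 0 := by
    have : (p * q * (1 + a)) ^ 2 = (2 * a * r) ^ 2 := by rw [e2]
    linear_combination this - (1 + a) ^ 2 * q ^ 2 * s12 - (1 + a) ^ 2 * a * s13
      + 4 * a ^ 2 * s23
  have : 0 < a ^ 2 * (1 - a) ^ 2 := by
    have : 0 < 1 - a := by linarith
    positivity
  linarith

end Card

/-! ### The Gegenbauer polynomial of degree four -/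

theorem gegenbauer_four {μ : ℝ} (hμ : μ ≠ 0) (x : ℝ) :
    gegenbauer μ 4 x = (12 * (μ * (μ + 1)) - 48 * (μ * (μ + 1) * (μ + 2)) * x ^ 2
      + 16 * (μ * (μ + 1) * (μ + 2) * (μ + 3)) * x ^ 4) / 24 := by
  let u : ℝ → ℝ := fun r => 1 - 2 * x * r + r ^ 2
  let w : ℝ → ℝ := fun r => 2 * r - 2 * x
  have hu (r : ℝ) : HasDerivAt u (w r) r := by
    have := (((hasDerivAt_id r).const_mul (2 * x)).const_sub 1).add ((hasDerivAt_id r).pow 2)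
    refine this.congr_deriv ?_
    simp [w]
    ring
  have hw (r : ℝ) : HasDerivAt w 2 r := by
    exact (((hasDerivAt_id r).const_mul 2).sub_const (2 * x)).congr_deriv (mul_one 2)
  -- Positivity of the base near `0` justifies the power rule there; each derivative must be known
  -- on a neighbourhood to be differentiated again.
  have hpos : ∀ᶠ r in 𝓝 (0 : ℝ), 0 < u r := by
    have hcont : ContinuousAt u 0 := (hu 0).continuousAt
    exact hcont.eventually (lt_mem_nhds (by simp [u]))
  have hrpow {r : ℝ} (hr : 0 < u r) (s : ℝ) :
      HasDerivAt (fun r => u r ^ s) (w r * s * u r ^ (s - 1)) r :=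
    (hu r).rpow_const (Or.inl hr.ne')
  have d1 : deriv (fun r => u r ^ (-μ)) =ᶠ[𝓝 0] fun r => -μ * (w r * u r ^ (-μ - 1)) := by
    filter_upwards [hpos] with r hr
    rw [(hrpow hr _).deriv]
    ring
  have d2 : deriv (fun r => -μ * (w r * u r ^ (-μ - 1))) =ᶠ[𝓝 0] fun r =>
      -2 * μ * u r ^ (-μ - 1) + μ * (μ + 1) * (w r ^ 2 * u r ^ (-μ - 1 - 1)) := by
    filter_upwards [hpos] with r hr
    refine (((hw r).mul (hrpow hr (-μ - 1))).const_mul (-μ)).deriv.trans ?_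
    ring
  have d3 : deriv (fun r => -2 * μ * u r ^ (-μ - 1)
        + μ * (μ + 1) * (w r ^ 2 * u r ^ (-μ - 1 - 1))) =ᶠ[𝓝 0] fun r =>
      6 * (μ * (μ + 1)) * (w r * u r ^ (-μ - 1 - 1))
        - μ * (μ + 1) * (μ + 2) * (w r ^ 3 * u r ^ (-μ - 1 - 1 - 1)) := by
    filter_upwards [hpos] with r hr
    refine (((hrpow hr (-μ - 1)).const_mul (-2 * μ)).add
      ((((hw r).pow 2).mul (hrpow hr (-μ - 1 - 1))).const_mul (μ * (μ + 1)))).deriv.trans ?_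
    simp only [Pi.pow_apply]
    push_cast
    ring
  have h0 (s : ℝ) : u 0 ^ s = 1 := by simp [u]
  have hu0 : 0 < u 0 := by simp [u]
  have d4 : deriv (fun r => 6 * (μ * (μ + 1)) * (w r * u r ^ (-μ - 1 - 1))
        - μ * (μ + 1) * (μ + 2) * (w r ^ 3 * u r ^ (-μ - 1 - 1 - 1))) 0
      = 12 * (μ * (μ + 1)) - 48 * (μ * (μ + 1) * (μ + 2)) * x ^ 2
        + 16 * (μ * (μ + 1) * (μ + 2) * (μ + 3)) * x ^ 4 := by
    refine ((((hw 0).mul (hrpow hu0 (-μ - 1 - 1))).const_mul (6 * (μ * (μ + 1)))).sub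
      ((((hw 0).pow 3).mul (hrpow hu0 (-μ - 1 - 1 - 1))).const_mul
        (μ * (μ + 1) * (μ + 2)))).deriv.trans ?_
    simp only [Pi.pow_apply, h0]
    simp only [w]
    push_cast
    ring
  have h : iteratedDeriv 4 (fun r => (1 - 2 * x * r + r ^ 2) ^ (-μ)) 0
      = 12 * (μ * (μ + 1)) - 48 * (μ * (μ + 1) * (μ + 2)) * x ^ 2
        + 16 * (μ * (μ + 1) * (μ + 2) * (μ + 3)) * x ^ 4 := by
    change iteratedDeriv 4 (fun r => u r ^ (-μ)) 0 = _
    simp only [iteratedDeriv_succ, iteratedDeriv_zero]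
    rw [(d1.deriv.deriv.deriv).eq_of_nhds, (d2.deriv.deriv).eq_of_nhds, d3.deriv.eq_of_nhds, d4]
  rw [gegenbauer, if_neg hμ, h]
  norm_num [Nat.factorial]

/-- The square vanishes at `√a`, which lies in the interval. -/
theorem sInf_image_quartic {f : ℝ → ℝ} {k a m : ℝ} (hk : 0 ≤ k) (ha : 0 ≤ a) (ha1 : a ≤ 1)
    (hf : ∀ x, f x = k * (x ^ 2 - a) ^ 2 + m) : sInf (f '' Set.Icc (-1) 1) = m := by
  refine IsLeast.csInf_eq ⟨⟨√a, ⟨?_, ?_⟩, ?_⟩, ?_⟩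
  · linarith [Real.sqrt_nonneg a]
  · exact Real.sqrt_le_one.2 ha1
  · rw [hf, Real.sq_sqrt ha]
    ring
  · rintro _ ⟨x, -, rfl⟩
    rw [hf]
    have : 0 ≤ k * (x ^ 2 - a) ^ 2 := by positivity
    linarith

theorem b_four_four : b 4 4 = 5 := by
  have hd : harmDim 4 4 = 25 := by norm_num [harmDim, Nat.choose]
  -- Completing the square in `x ^ 2`; the centre `3/8` is `3/(n+4)`, the squared cosine found for
  -- tight designs.
  have hQ (x : ℝ) : Q 4 4 x = 80 * (x ^ 2 - 3 / 8) ^ 2 + -(25 / 4) := by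
    rw [Q, hd, gegenbauer_four (by norm_num), gegenbauer_four (by norm_num)]
    norm_num
    ring
  rw [b, c, sInf_image_quartic (by norm_num) (by norm_num) (by norm_num) hQ, hd]
  norm_num

theorem b_five_four : b 5 4 = 7 := by
  have hd : harmDim 5 4 = 55 := by norm_num [harmDim, Nat.choose]
  have hQ (x : ℝ) : Q 5 4 x = 1155 / 8 * (x ^ 2 - 1 / 3) ^ 2 + -(55 / 6) := by
    rw [Q, hd, gegenbauer_four (by norm_num), gegenbauer_four (by norm_num)]
    norm_num
    ring
  rw [b, c, sInf_image_quartic (by norm_num) (by norm_num) (by norm_num) hQ, hd]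
  norm_num

end HarmonicIndexDesign

theorem mainTheorem9 (n : ℕ) (hn : n = 4 ∨ n = 5) :
    ¬ ∃ X : Finset (EuclideanSpace ℝ (Fin n)), HarmonicIndexDesign.IsTightDesign 4 X := by
  rintro ⟨X, hX, hc⟩
  rcases hn with rfl | rfl
  · rw [HarmonicIndexDesign.b_four_four] at hc
    exact hX.card_ne (by norm_num) (by rw [hc]; norm_num)
  · rw [HarmonicIndexDesign.b_five_four] at hc
    exact hX.card_ne (by norm_num) (by rw [hc]; norm_num)
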